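/- Let $d\ge 0$ be an integer and let $P=\mathbb{Z}_{\ge 0}^{d+1}$ with the componentwise partial order. For $t\ge 0$ let the layer $L_t$ be the set of $u\in P$ whose coordinates sum to $t$, and for $v\in P$ let $\mathfrak p(v)$ be the set of elements of $P$ covered by $v$. Let $\alpha_1,\dots,\alpha_{d+1}>0$, $\varepsilon>0$, $\mu_0\in\mathbb{R}$ and $\sigma_0^2>0$ be real numbers. Let $X_0\sim\mathcal N(\mu_0,\sigma_0^2)$, and let $W_{u\to v}\sim\mathcal N(0,1)$, indexed by the pairs such that $v$ covers $u$, be i.i.d. and jointly independent of $X_0$. Put $X_{\boldsymbol 0}:=X_0$ and, for $v\neq\boldsymbol 0$, $$X_v:=\alpha_{|\mathfrak p(v)|}\sum_{u\in\mathfrak p(v)}\bigl(X_u+\varepsilon\, W_{u\to v}\bigr).$$ Write $\operatorname{corr}(\zeta,X_0)=\operatorname{Cov}(\zeta,X_0)/\sqrt{\operatorname{Var}(\zeta)\operatorname{Var}(X_0)}$. Reconstruction is said to be possible if there is a function $c:P\to\mathbb{R}$ such that the random variables $\zeta_t:=\sum_{u\in L_t}c_uX_u$ satisfy $\operatorname{Var}(\zeta_t)>0$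 for every $t\ge 0$ and $\operatorname{corr}(\zeta_t,X_0)$ does not converge to $0$ as $t\to\infty$. Convex reconstruction is said to be possible if moreover $c$ can be chosen with $c_u\ge 0$ for all $u\in P$. (a) If $\alpha_i>1/i$ for some $i\in\{1,\dots,d+1\}$, then convex reconstruction is possible. (b) If $\alpha_i\le 1/i$ for every $i\in\{1,\dots,d+1\}$, then reconstruction is not possible; moreover, the best correlation $\sup_{\zeta}\operatorname{corr}(\zeta,X_0)$, the supremum being over all $\zeta=\sum_{u\in L_t}c_uX_u$ with real coefficients $c_u$ $(u\in L_t)$ that are not all zero, tends to $0$ as $t\to\infty$. -/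

import Mathlib

open MeasureTheory ProbabilityTheory Filter Topology
open scoped NNReal

namespace GaussianBroadcast

/-- The poset `ℤ_{≥0}^{d+1}`; its order is Mathlib's componentwise order on functions. -/
abbrev Vertex (d : ℕ) : Type := Fin (d + 1) → ℕ

/-- The `t`-th layer: all vertices whose coordinates sum to `t`. It is finite. -/
def layer (d t : ℕ) : Finset (Vertex d) := Finset.piAntidiag Finset.univ t

theorem mem_layer {d t : ℕ} {u : Vertex d} : u ∈ layer d t ↔ ∑ i, u i = t := by
  simp [layer]

open Classical in
/-- The set `𝔭(v)` of all vertices covered by `v`. -/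
noncomputable def parents {d : ℕ} (v : Vertex d) : Finset (Vertex d) :=
  {u ∈ Finset.Iic v | u ⋖ v}

theorem mem_parents {d : ℕ} {u v : Vertex d} : u ∈ parents v ↔ u ⋖ v := by
  simp only [parents, Finset.mem_filter, Finset.mem_Iic, and_iff_right_iff_imp]
  exact fun h => h.le

/-- The covering pairs `u ⋖ v`, that is, the edges `u → v` of the Hasse diagram. -/
abbrev Edge (d : ℕ) : Type := {e : Vertex d × Vertex d // e.1 ⋖ e.2}

/-- The random variable `X_v`, built from the root signal `X₀` and the edge noises `W` by
`X_0 = X₀` and, for `v ≠ 0`, `X_v = α_{|𝔭(v)|} ∑_{u ∈ 𝔭(v)} (X_u + ε W_{u → v})`. -/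
noncomputable def signal {Ω : Type*} {d : ℕ} (α : ℕ → ℝ) (ε : ℝ) (X₀ : Ω → ℝ)
    (W : Edge d → Ω → ℝ) (v : Vertex d) (ω : Ω) : ℝ :=
  open Classical in
  if v = 0 then X₀ ω
  else α (parents v).card *
    ∑ u : {u // u ∈ parents v},
      (signal α ε X₀ W u.1 ω + ε * W ⟨(u.1, v), mem_parents.1 u.2⟩ ω)
termination_by ∑ i, v i
decreasing_by
  obtain ⟨hle, i, hi⟩ := Pi.lt_def.1 (mem_parents.1 u.2).lt
  exact Finset.sum_lt_sum (fun j _ => hle j) ⟨i, Finset.mem_univ i, hi⟩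

/-- The inputs of the model: `X₀ ∼ N(μ₀, v₀)`, the noises `W` are i.i.d. standard Gaussian,
and the whole family `W` is independent of `X₀`. -/
structure IsModelInput {Ω : Type*} [MeasurableSpace Ω] (P : Measure Ω) {d : ℕ} (μ₀ : ℝ) (v₀ : ℝ≥0)
    (X₀ : Ω → ℝ) (W : Edge d → Ω → ℝ) : Prop where
  law_root : HasLaw X₀ (gaussianReal μ₀ v₀) P
  law_noise : ∀ e, HasLaw (W e) (gaussianReal 0 1) P
  indep_noise : iIndepFun W P
  indep_root : IndepFun X₀ (fun ω e => W e ω) P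

/-- The estimator `ζ_t = ∑_{u ∈ L_t} c_u X_u`. -/
noncomputable def estimator {Ω : Type*} {d : ℕ} (X : Vertex d → Ω → ℝ) (c : Vertex d → ℝ) (t : ℕ)
    (ω : Ω) : ℝ :=
  ∑ u ∈ layer d t, c u * X u ω

/-- The correlation `Cov(Y, Z) / √(Var(Y) Var(Z))`. -/
noncomputable def corr {Ω : Type*} [MeasurableSpace Ω] (P : Measure Ω) (Y Z : Ω → ℝ) : ℝ :=
  covariance Y Z P / √(variance Y P * variance Z P)

/-- The coefficients `c` witness reconstruction: every `ζ_t` has positive variance and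
`corr(ζ_t, X₀)` does not converge to `0`. Since layers are finite here, every `c` has finite
support on each layer. -/
def Reconstructs {Ω : Type*} [MeasurableSpace Ω] (P : Measure Ω) {d : ℕ} (X : Vertex d → Ω → ℝ)
    (X₀ : Ω → ℝ) (c : Vertex d → ℝ) : Prop :=
  (∀ t, 0 < variance (estimator X c t) P) ∧
    ¬ Tendsto (fun t => corr P (estimator X c t) X₀) atTop (𝓝 0)

/-- Reconstruction is possible. -/
def ReconstructionPossible {Ω : Type*} [MeasurableSpace Ω] (P : Measure Ω) {d : ℕ}
    (X : Vertex d → Ω → ℝ) (X₀ : Ω → ℝ) : Prop :=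
  ∃ c : Vertex d → ℝ, Reconstructs P X X₀ c

/-- Convex reconstruction is possible: the coefficients can be chosen nonnegative. -/
def ConvexReconstructionPossible {Ω : Type*} [MeasurableSpace Ω] (P : Measure Ω) {d : ℕ}
    (X : Vertex d → Ω → ℝ) (X₀ : Ω → ℝ) : Prop :=
  ∃ c : Vertex d → ℝ, (∀ u, 0 ≤ c u) ∧ Reconstructs P X X₀ c

/-- The best correlation with `X₀` on layer `t`: the supremum of `corr(ζ, X₀)` over all
`ζ = ∑_{u ∈ L_t} c_u X_u` whose coefficients are not all zero. It is taken in the extended reals,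
where every supremum exists. -/
noncomputable def bestCorr {Ω : Type*} [MeasurableSpace Ω] (P : Measure Ω) {d : ℕ}
    (X : Vertex d → Ω → ℝ) (X₀ : Ω → ℝ) (t : ℕ) : EReal :=
  ⨆ c : {c : Vertex d → ℝ // ∃ u ∈ layer d t, c u ≠ 0},
    ((corr P (estimator X c.1 t) X₀ : ℝ) : EReal)

end GaussianBroadcast

namespace GaussianBroadcast

/-! ### Covering relation and supports -/

variable {d : ℕ}

/-! Pulling the coefficients of a linear estimator down the layers by the transposed evolution
`pullback` yields a function `h` with ζ_t = h(0) X₀ + (weighted sum of independent edge noises)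
(`estimator_signal`). The covariance with X₀ is h(0)v₀, and the noise variance is comparable to the
sum of h² over the layers 1, …, t. Reconstruction thus turns on square-summable fixed points of
`pullback` with h(0) ≠ 0.

If some α_i > 1/i, take the least such i and a face spanned by i coordinates. A fixed point b_k
r^|v|, with k the support size of v and r = 1/(iα_i) < 1, lives on this face
(`exists_decaying_fixedPoint`). Geometric decay beats polynomial layer growth, so the noise stays
bounded.

If all α_i ≤ 1/i, a fixed point vanishing at infinity has h(0) = 0: a maximum principle kills it on
one support size after another, from the largest down (`eq_zero_of_fixedPoint_of_tendsto`). By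
compactness the noise cost of h(0) = 1 then tends to infinity (`eventually_lt_sum_sq`), which bounds
the correlation uniformly in the coefficients. -/

theorem covBy_iff_exists_add_single {u v : Vertex d} :
    u ⋖ v ↔ ∃ j, v = u + Pi.single j 1 := by
  rw [Pi.covBy_iff_exists_right_eq]
  simp only [Nat.covBy_iff_add_one_eq]
  constructor
  · rintro ⟨j, x, rfl, rfl⟩
    refine ⟨j, funext fun k => ?_⟩
    by_cases h : k = j
    · subst h; simp
    · simp [h]
  · rintro ⟨j, rfl⟩
    refine ⟨j, _, rfl, funext fun k => ?_⟩
    by_cases h : k = j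
    · subst h; simp
    · simp [h]

/-- The set of nonzero coordinates of a vertex. -/
def coordSupport (v : Vertex d) : Finset (Fin (d + 1)) := {j | v j ≠ 0}

theorem mem_coordSupport {v : Vertex d} {j : Fin (d + 1)} : j ∈ coordSupport v ↔ v j ≠ 0 := by
  simp [coordSupport]

theorem coordSupport_zero : coordSupport (0 : Vertex d) = ∅ := by
  ext
  simp [mem_coordSupport]

theorem coordSupport_add_single (v : Vertex d) (j : Fin (d + 1)) :
    coordSupport (v + Pi.single j 1) = insert j (coordSupport v) := by
  ext k
  by_cases h : k = j
  · subst h; simp [mem_coordSupport]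
  · simp [mem_coordSupport, h]

/-- Each parent arises by lowering exactly one nonzero coordinate, so the index of α depends only on
the support. -/
theorem card_parents (v : Vertex d) : (parents v).card = (coordSupport v).card := by
  symm
  refine Finset.card_bij (fun j _ => v - Pi.single j 1) ?_ ?_ ?_
  · intro j hj
    rw [mem_coordSupport] at hj
    rw [mem_parents, covBy_iff_exists_add_single]
    refine ⟨j, funext fun k => ?_⟩
    by_cases h : k = j
    · subst h; simp; omega
    · simp [h]
  · intro j hj k hk h
    by_contra hjk
    rw [mem_coordSupport] at hj
    have := congrFun h j
    simp [hjk] at this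
    omega
  · intro u hu
    obtain ⟨j, rfl⟩ := covBy_iff_exists_add_single.1 (mem_parents.1 hu)
    refine ⟨j, by simp [mem_coordSupport], by simp⟩

theorem sum_add_single (v : Vertex d) (j : Fin (d + 1)) :
    ∑ i, (v + Pi.single j 1 : Vertex d) i = ∑ i, v i + 1 := by
  simp [Finset.sum_add_distrib]

/-! ### Transposed evolution and edge decomposition -/

/-- The transpose of the one-layer evolution of the signal: it turns the coefficients of a linear
estimator on one layer into the coefficients on the layer below it. -/
noncomputable def pullback (α : ℕ → ℝ) (f : Vertex d → ℝ) (u : Vertex d) : ℝ :=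
  ∑ j, α (parents (u + Pi.single j 1)).card * f (u + Pi.single j 1)

theorem sum_layer_succ_parents (g : Vertex d → Vertex d → ℝ) (s : ℕ) :
    ∑ v ∈ layer d (s + 1), ∑ u ∈ parents v, g u v =
      ∑ u ∈ layer d s, ∑ j, g u (u + Pi.single j 1) := by
  have h (u : Vertex d) : ∑ j, g u (u + Pi.single j 1) =
      ∑ v ∈ Finset.univ.image (fun j : Fin (d + 1) => u + Pi.single j 1), g u v := by
    rw [Finset.sum_image]
    intro j _ k _ hjk
    by_contra hne
    have := congrFun hjk j
    simp [hne] at this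
  simp_rw [h]
  refine Finset.sum_comm' fun v u => ?_
  simp only [mem_parents, covBy_iff_exists_add_single, Finset.mem_image, Finset.mem_univ, true_and,
    mem_layer]
  constructor
  · rintro ⟨hv, j, rfl⟩
    rw [sum_add_single] at hv
    exact ⟨⟨j, rfl⟩, by omega⟩
  · rintro ⟨⟨j, rfl⟩, hu⟩
    exact ⟨by rw [sum_add_single, hu], j, rfl⟩

/-- The edges ending at `v`. -/
noncomputable def inEdges (v : Vertex d) : Finset (Edge d) :=
  (parents v).attach.map ⟨fun u => ⟨(u.1, v), mem_parents.1 u.2⟩, fun _ _ h =>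
    Subtype.ext (congrArg (fun e : Edge d => e.1.1) h)⟩

theorem sum_inEdges (v : Vertex d) (f : Edge d → ℝ) :
    ∑ e ∈ inEdges v, f e =
      ∑ u ∈ (parents v).attach, f ⟨(u.1, v), mem_parents.1 u.2⟩ :=
  Finset.sum_map _ _ _

theorem target_of_mem_inEdges {v : Vertex d} {e : Edge d} (he : e ∈ inEdges v) : e.1.2 = v := by
  simp only [inEdges, Finset.mem_map] at he
  obtain ⟨u, -, rfl⟩ := he
  rfl

/-- The edges ending in the layers `1, …, t`. -/
noncomputable def edgesUpTo (d t : ℕ) : Finset (Edge d) :=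
  (Finset.range t).biUnion fun r => (layer d (r + 1)).biUnion inEdges

theorem sum_edgesUpTo (f : Edge d → ℝ) (t : ℕ) :
    ∑ e ∈ edgesUpTo d t, f e =
      ∑ r ∈ Finset.range t, ∑ v ∈ layer d (r + 1), ∑ e ∈ inEdges v, f e := by
  rw [edgesUpTo, Finset.sum_biUnion]
  · refine Finset.sum_congr rfl fun r _ => Finset.sum_biUnion ?_
    intro v _ w _ hvw
    refine Finset.disjoint_left.2 fun e hv hw => hvw ?_
    rw [← target_of_mem_inEdges hv, ← target_of_mem_inEdges hw]
  · intro r _ s _ hrs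
    refine Finset.disjoint_left.2 fun e hr hs => hrs ?_
    simp only [Finset.mem_biUnion] at hr hs
    obtain ⟨v, hv, hev⟩ := hr
    obtain ⟨w, hw, hew⟩ := hs
    rw [mem_layer, ← target_of_mem_inEdges hev] at hv
    rw [mem_layer, ← target_of_mem_inEdges hew] at hw
    omega

theorem signal_zero {Ω : Type*} (α : ℕ → ℝ) (ε : ℝ) (X₀ : Ω → ℝ) (W : Edge d → Ω → ℝ) (ω : Ω) :
    signal α ε X₀ W 0 ω = X₀ ω := by
  rw [signal, if_pos rfl]

theorem signal_of_ne_zero {Ω : Type*} (α : ℕ → ℝ) (ε : ℝ) (X₀ : Ω → ℝ) (W : Edge d → Ω → ℝ)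
    {v : Vertex d} (hv : v ≠ 0) (ω : Ω) :
    signal α ε X₀ W v ω = α (parents v).card * (∑ u ∈ parents v, signal α ε X₀ W u ω) +
      ∑ e ∈ inEdges v, ε * α (parents v).card * W e ω := by
  rw [signal, if_neg hv, sum_inEdges, Finset.univ_eq_attach, Finset.sum_add_distrib,
    mul_add, Finset.sum_attach (parents v) (fun u => signal α ε X₀ W u ω),
    Finset.mul_sum (parents v).attach]
  congr 1
  exact Finset.sum_congr rfl fun u _ => by ring

/-- The coefficient of the edge noise `W e` in a linear estimator whose coefficients are pulled
back along the layers to `h`. -/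
noncomputable def noiseCoeff (α : ℕ → ℝ) (ε : ℝ) (h : Vertex d → ℝ) (e : Edge d) : ℝ :=
  ε * α (parents e.1.2).card * h e.1.2

/-- Induction on the layer: expanding the top layer by the recursion and regrouping by parents
replaces `h` there by `pullback α h` one layer below, at the cost of the noise on the edges between
them. -/
theorem estimator_signal {Ω : Type*} {α : ℕ → ℝ} {h : Vertex d → ℝ} {t : ℕ}
    (hh : ∀ u, ∑ i, u i < t → h u = pullback α h u) (ε : ℝ) (X₀ : Ω → ℝ) (W : Edge d → Ω → ℝ)
    (ω : Ω) :
    estimator (signal α ε X₀ W) h t ω =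
      h 0 * X₀ ω + ∑ e ∈ edgesUpTo d t, noiseCoeff α ε h e * W e ω := by
  induction t with
  | zero =>
    have : layer d 0 = {0} := by
      ext u
      simp [mem_layer, funext_iff]
    simp [estimator, edgesUpTo, this, signal_zero]
  | succ t ih =>
    have ih := ih fun u hu => hh u (by omega)
    rw [sum_edgesUpTo, Finset.sum_range_succ, ← sum_edgesUpTo, ← add_assoc, ← ih]
    have key : ∀ v ∈ layer d (t + 1), h v * signal α ε X₀ W v ω =
        ∑ u ∈ parents v, α (parents v).card * h v * signal α ε X₀ W u ω +
          ∑ e ∈ inEdges v, noiseCoeff α ε h e * W e ω := by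
      intro v hv
      have hv0 : v ≠ 0 := by
        rintro rfl
        simp [mem_layer] at hv
      rw [signal_of_ne_zero _ _ _ _ hv0, mul_add, Finset.mul_sum, Finset.mul_sum, Finset.mul_sum]
      congr 1
      · exact Finset.sum_congr rfl fun u _ => by ring
      · refine Finset.sum_congr rfl fun e he => ?_
        rw [noiseCoeff, target_of_mem_inEdges he]
        ring
    rw [estimator, Finset.sum_congr rfl key, Finset.sum_add_distrib,
      sum_layer_succ_parents (fun u v => α (parents v).card * h v * signal α ε X₀ W u ω)]
    congr 1
    refine Finset.sum_congr rfl fun u hu => ?_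
    rw [hh u (by rw [mem_layer] at hu; omega), pullback, Finset.sum_mul]

/-- The variance contributed by the edge noises to the estimator with coefficients `h`. -/
noncomputable def noiseVariance (α : ℕ → ℝ) (ε : ℝ) (h : Vertex d → ℝ) (t : ℕ) : ℝ :=
  ∑ r ∈ Finset.range t, ∑ v ∈ layer d (r + 1),
    (parents v).card * (ε * α (parents v).card * h v) ^ 2

theorem sum_sq_noiseCoeff (α : ℕ → ℝ) (ε : ℝ) (h : Vertex d → ℝ) (t : ℕ) :
    ∑ e ∈ edgesUpTo d t, noiseCoeff α ε h e ^ 2 = noiseVariance α ε h t := by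
  rw [sum_edgesUpTo]
  refine Finset.sum_congr rfl fun r _ => Finset.sum_congr rfl fun v _ => ?_
  have : ∀ e ∈ inEdges v, noiseCoeff α ε h e ^ 2 = (ε * α (parents v).card * h v) ^ 2 := by
    intro e he
    rw [noiseCoeff, target_of_mem_inEdges he]
  rw [Finset.sum_congr rfl this, Finset.sum_const, nsmul_eq_mul, inEdges, Finset.card_map,
    Finset.card_attach]

theorem noiseVariance_nonneg (α : ℕ → ℝ) (ε : ℝ) (h : Vertex d → ℝ) (t : ℕ) :
    0 ≤ noiseVariance α ε h t :=
  Finset.sum_nonneg fun _ _ => Finset.sum_nonneg fun _ _ => by positivity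

/-! ### Second moments of estimators -/

namespace IsModelInput

variable {Ω : Type*} [MeasurableSpace Ω] {P : Measure Ω} {μ₀ : ℝ} {v₀ : ℝ≥0}
  {X₀ : Ω → ℝ} {W : Edge d → Ω → ℝ}

theorem memLp_root (hXW : IsModelInput P μ₀ v₀ X₀ W) : MemLp X₀ 2 P := by
  have := memLp_id_gaussianReal (μ := μ₀) (v := v₀) 2
  rw [← hXW.law_root.map_eq] at this
  exact (memLp_map_measure_iff aestronglyMeasurable_id hXW.law_root.aemeasurable).1 this

theorem memLp_noise (hXW : IsModelInput P μ₀ v₀ X₀ W) (e : Edge d) : MemLp (W e) 2 P := by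
  have := memLp_id_gaussianReal (μ := 0) (v := 1) 2
  rw [← (hXW.law_noise e).map_eq] at this
  exact (memLp_map_measure_iff aestronglyMeasurable_id (hXW.law_noise e).aemeasurable).1 this

theorem variance_root (hXW : IsModelInput P μ₀ v₀ X₀ W) : variance X₀ P = v₀ := by
  rw [hXW.law_root.variance_eq, variance_id_gaussianReal]

theorem variance_noise (hXW : IsModelInput P μ₀ v₀ X₀ W) (e : Edge d) :
    variance (W e) P = 1 := by
  rw [(hXW.law_noise e).variance_eq, variance_id_gaussianReal]
  simp

theorem memLp_noise_sum (hXW : IsModelInput P μ₀ v₀ X₀ W) (s : Finset (Edge d))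
    (a : Edge d → ℝ) : MemLp (fun ω => ∑ e ∈ s, a e * W e ω) 2 P :=
  memLp_finsetSum s fun e _ => (hXW.memLp_noise e).const_mul (a e)

theorem indepFun_noise_sum (hXW : IsModelInput P μ₀ v₀ X₀ W) (s : Finset (Edge d))
    (a : Edge d → ℝ) : IndepFun X₀ (fun ω => ∑ e ∈ s, a e * W e ω) P :=
  hXW.indep_root.comp (φ := id) (ψ := fun w : Edge d → ℝ => ∑ e ∈ s, a e * w e) measurable_id
    (by fun_prop)

theorem variance_noise_sum [IsProbabilityMeasure P] (hXW : IsModelInput P μ₀ v₀ X₀ W)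
    (s : Finset (Edge d)) (a : Edge d → ℝ) :
    variance (fun ω => ∑ e ∈ s, a e * W e ω) P = ∑ e ∈ s, a e ^ 2 := by
  have h := IndepFun.variance_sum (μ := P) (X := fun e ω => a e * W e ω) (s := s)
    (fun e _ => (hXW.memLp_noise e).const_mul (a e))
    (fun e _ e' _ hne => (hXW.indep_noise.indepFun hne).comp (φ := fun x => a e * x)
      (ψ := fun x => a e' * x) (measurable_const_mul _) (measurable_const_mul _))
  rw [show (fun ω => ∑ e ∈ s, a e * W e ω) = ∑ e ∈ s, fun ω => a e * W e ω by
    ext ω; simp, h]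
  refine Finset.sum_congr rfl fun e _ => ?_
  rw [variance_const_mul, hXW.variance_noise, mul_one]

variable [IsProbabilityMeasure P] {α : ℕ → ℝ} {h : Vertex d → ℝ} {t : ℕ}

theorem variance_estimator (hXW : IsModelInput P μ₀ v₀ X₀ W)
    (hh : ∀ u, ∑ i, u i < t → h u = pullback α h u) (ε : ℝ) :
    variance (estimator (signal α ε X₀ W) h t) P = h 0 ^ 2 * v₀ + noiseVariance α ε h t := by
  rw [show estimator (signal α ε X₀ W) h t = (fun ω => h 0 * X₀ ω) +
    fun ω => ∑ e ∈ edgesUpTo d t, noiseCoeff α ε h e * W e ω from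
    funext fun ω => estimator_signal hh ε X₀ W ω]
  rw [IndepFun.variance_add (hXW.memLp_root.const_mul _) (hXW.memLp_noise_sum _ _)
    ((hXW.indepFun_noise_sum _ _).comp (φ := fun x => h 0 * x) (ψ := id)
      (measurable_const_mul _) measurable_id), variance_const_mul, hXW.variance_root,
    hXW.variance_noise_sum, sum_sq_noiseCoeff]

theorem covariance_estimator (hXW : IsModelInput P μ₀ v₀ X₀ W)
    (hh : ∀ u, ∑ i, u i < t → h u = pullback α h u) (ε : ℝ) :
    covariance (estimator (signal α ε X₀ W) h t) X₀ P = h 0 * v₀ := by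
  rw [show estimator (signal α ε X₀ W) h t = (fun ω => h 0 * X₀ ω) +
    fun ω => ∑ e ∈ edgesUpTo d t, noiseCoeff α ε h e * W e ω from
    funext fun ω => estimator_signal hh ε X₀ W ω]
  rw [covariance_add_left (hXW.memLp_root.const_mul _) (hXW.memLp_noise_sum _ _) hXW.memLp_root,
    covariance_const_mul_left, covariance_self hXW.law_root.aemeasurable, hXW.variance_root,
    (hXW.indepFun_noise_sum _ _).symm.covariance_eq_zero (hXW.memLp_noise_sum _ _) hXW.memLp_root,
    add_zero]

theorem corr_estimator (hXW : IsModelInput P μ₀ v₀ X₀ W)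
    (hh : ∀ u, ∑ i, u i < t → h u = pullback α h u) (ε : ℝ) :
    corr P (estimator (signal α ε X₀ W) h t) X₀ =
      h 0 * v₀ / √((h 0 ^ 2 * v₀ + noiseVariance α ε h t) * v₀) := by
  rw [corr, hXW.covariance_estimator hh, hXW.variance_estimator hh, hXW.variance_root]

end IsModelInput

/-! ### Supercritical case: a decaying fixed point -/

theorem card_layer_le (d t : ℕ) : (layer d t).card ≤ (t + 1) ^ (d + 1) := by
  calc (layer d t).card ≤ (Fintype.piFinset fun _ : Fin (d + 1) => Finset.range (t + 1)).card := by
        refine Finset.card_le_card fun u hu => ?_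
        rw [mem_layer] at hu
        simp only [Fintype.mem_piFinset, Finset.mem_range]
        intro j
        have := Finset.single_le_sum (f := u) (fun _ _ => Nat.zero_le _) (Finset.mem_univ j)
        omega
    _ = (t + 1) ^ (d + 1) := by simp

theorem card_coordSupport_le (v : Vertex d) : (coordSupport v).card ≤ d + 1 := by
  simpa using Finset.card_le_univ (coordSupport v)

theorem exists_noiseVariance_le (α : ℕ → ℝ) (ε : ℝ) {h : Vertex d → ℝ} {B r : ℝ} (hr₀ : 0 ≤ r)
    (hr₁ : r < 1) (hh : ∀ v, |h v| ≤ B * r ^ ∑ i, v i) :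
    ∃ K, ∀ t, noiseVariance α ε h t ≤ K := by
  set A : ℝ := ∑ k ∈ Finset.range (d + 2), k * (ε * α k) ^ 2
  have hA₀ : 0 ≤ A := Finset.sum_nonneg fun _ _ => by positivity
  have hA (v : Vertex d) : (parents v).card * (ε * α (parents v).card) ^ 2 ≤ A :=
    Finset.single_le_sum (f := fun k : ℕ => (k : ℝ) * (ε * α k) ^ 2)
      (fun _ _ => by positivity) (Finset.mem_range.2 (by
        rw [card_parents]; have := card_coordSupport_le v; omega))
  have hs : Summable fun n : ℕ => (n : ℝ) ^ (d + 1) * (r ^ 2) ^ n :=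
    summable_pow_mul_geometric_of_norm_lt_one (d + 1) (by
      rw [Real.norm_of_nonneg (by positivity)]; exact pow_lt_one₀ hr₀ hr₁ two_ne_zero)
  -- The factor 2^(d+1) comes from bounding the layer size by (n+2)^(d+1) ≤ (2(n+1))^(d+1).
  have hs : Summable fun n : ℕ =>
      2 ^ (d + 1) * A * B ^ 2 * (((n + 1 : ℕ) : ℝ) ^ (d + 1) * (r ^ 2) ^ (n + 1)) :=
    ((summable_nat_add_iff 1).2 hs).mul_left _
  refine ⟨_, fun t => le_trans (Finset.sum_le_sum fun n _ => ?_)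
    (hs.sum_le_tsum (Finset.range t) fun n _ => by positivity)⟩
  calc ∑ v ∈ layer d (n + 1), ((parents v).card : ℝ) * (ε * α (parents v).card * h v) ^ 2
      ≤ ∑ v ∈ layer d (n + 1), A * (B ^ 2 * (r ^ 2) ^ (n + 1)) := by
        refine Finset.sum_le_sum fun v hv => ?_
        have h1 : h v ^ 2 ≤ B ^ 2 * (r ^ 2) ^ (n + 1) := by
          have := pow_le_pow_left₀ (abs_nonneg _) (hh v) 2
          rw [sq_abs, mem_layer.1 hv] at this
          calc _ ≤ _ := this
            _ = _ := by ring
        calc ((parents v).card : ℝ) * (ε * α (parents v).card * h v) ^ 2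
            = ((parents v).card * (ε * α (parents v).card) ^ 2) * h v ^ 2 := by ring
          _ ≤ _ := mul_le_mul (hA v) h1 (sq_nonneg _) hA₀
    _ = (layer d (n + 1)).card * (A * (B ^ 2 * (r ^ 2) ^ (n + 1))) := by
        rw [Finset.sum_const, nsmul_eq_mul]
    _ ≤ (2 * ((n + 1 : ℕ) : ℝ)) ^ (d + 1) * (A * (B ^ 2 * (r ^ 2) ^ (n + 1))) := by
        gcongr
        refine (Nat.cast_le.2 (card_layer_le d (n + 1))).trans ?_
        push_cast
        gcongr
        linarith
    _ = _ := by rw [mul_pow]; ring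

/-- This is the fixed-point equation for b_k r^|v| at support size k < i: k raised coordinates keep
the support, i - k enlarge it. Solving for b_k divides by 1 - kα_k r > 0, so the weights are found
downwards from b_i = 1. -/
theorem exists_faceWeights {α : ℕ → ℝ} {i : ℕ} {r : ℝ} (hr : 0 < r)
    (hα : ∀ k, 1 ≤ k → k ≤ i → 0 < α k) (hr' : ∀ k < i, k * α k * r < 1) :
    ∃ b : ℕ → ℝ, (∀ k ≤ i, 0 < b k) ∧
      ∀ k < i, b k = k * (α k * (b k * r)) + (i - k : ℕ) * (α (k + 1) * (b (k + 1) * r)) := by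
  -- Indexed by codimension: c m is the weight b_(i-m).
  let c : ℕ → ℝ := Nat.rec 1 fun m x =>
    (m + 1) * α (i - m) * r * x / (1 - (i - (m + 1) : ℕ) * α (i - (m + 1)) * r)
  have hc (m : ℕ) : c (m + 1) =
    (m + 1) * α (i - m) * r * c m / (1 - (i - (m + 1) : ℕ) * α (i - (m + 1)) * r) := rfl
  have hpos : ∀ m ≤ i, 0 < c m := by
    intro m
    induction m with
    | zero => exact fun _ => one_pos
    | succ m ih =>
      intro hm
      rw [hc]
      have := ih (by omega)
      have := hα (i - m) (by omega) (by omega)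
      have := sub_pos.2 (hr' (i - (m + 1)) (by omega))
      positivity
  refine ⟨fun k => c (i - k), fun k _ => hpos _ (by omega), fun k hk => ?_⟩
  obtain ⟨m, rfl⟩ : ∃ m, i = k + 1 + m := ⟨i - (k + 1), by omega⟩
  have hne := (sub_pos.2 (hr' k hk)).ne'
  have h1 := hc m
  rw [show k + 1 + m - m = k + 1 by omega, show k + 1 + m - (m + 1) = k by omega,
    eq_div_iff hne] at h1
  simp only [show k + 1 + m - k = m + 1 by omega, show k + 1 + m - (k + 1) = m by omega]
  push_cast
  linear_combination h1

theorem exists_decaying_fixedPoint {α : ℕ → ℝ} (hα : ∀ i ∈ Finset.Icc 1 (d + 1), 0 < α i)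
    (hi : ∃ i ∈ Finset.Icc 1 (d + 1), 1 / (i : ℝ) < α i) :
    ∃ h : Vertex d → ℝ, (∀ v, 0 ≤ h v) ∧ 0 < h 0 ∧ (∀ u, h u = pullback α h u) ∧
      ∃ B r : ℝ, 0 ≤ r ∧ r < 1 ∧ ∀ v, |h v| ≤ B * r ^ ∑ i, v i := by
  classical
  -- Minimality of i gives kα_k ≤ 1 for 1 ≤ k < i, hence kα_k r < 1.
  obtain ⟨⟨himem, hiα⟩, himin⟩ := And.intro (Nat.find_spec hi) fun k => Nat.find_min hi (m := k)
  set i := Nat.find hi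
  obtain ⟨hi1, hid⟩ := Finset.mem_Icc.1 himem
  have hi0 : (0 : ℝ) < i := by exact_mod_cast hi1
  have hiα' : 1 < i * α i := by rwa [div_lt_iff₀ hi0, mul_comm] at hiα
  -- Forced by the fixed-point equation at support size i, which reads iα_i r = 1.
  set r : ℝ := (i * α i)⁻¹
  have hr0 : 0 < r := by positivity
  have hr1 : r < 1 := inv_lt_one_of_one_lt₀ hiα'
  have hri : i * (α i * r) = 1 := by
    rw [← mul_assoc]; exact mul_inv_cancel₀ (by positivity)
  have hlow : ∀ k < i, k * α k * r < 1 := by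
    intro k hk
    rcases Nat.eq_zero_or_pos k with rfl | hk0
    · simp
    have hmem : k ∈ Finset.Icc 1 (d + 1) := Finset.mem_Icc.2 ⟨hk0, by omega⟩
    have h1 : α k ≤ 1 / k := by
      by_contra hcon
      exact himin k hk ⟨hmem, not_le.1 hcon⟩
    have hk0' : (0 : ℝ) < k := by exact_mod_cast hk0
    rw [le_div_iff₀ hk0', mul_comm] at h1
    have := hα k hmem
    nlinarith
  obtain ⟨b, hb, hbrec⟩ := exists_faceWeights hr0
    (fun k h1 h2 => hα k (Finset.mem_Icc.2 ⟨h1, by omega⟩)) hlow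
  let I : Finset (Fin (d + 1)) := {j | (j : ℕ) < i}
  have hI : I.card = i := by
    simp only [I]
    rw [Fin.card_filter_val_lt]
    omega
  let h : Vertex d → ℝ := fun v =>
    if coordSupport v ⊆ I then b (coordSupport v).card * r ^ ∑ j, v j else 0
  have hcard {v : Vertex d} (hv : coordSupport v ⊆ I) : (coordSupport v).card ≤ i :=
    hI ▸ Finset.card_le_card hv
  have hnn (v : Vertex d) : 0 ≤ h v := by
    simp only [h]
    split_ifs with hv
    · exact mul_nonneg (hb _ (hcard hv)).le (by positivity)
    · exact le_rfl
  refine ⟨h, hnn, ?_, ?_, ∑ k ∈ Finset.range (i + 1), b k, r, hr0.le, hr1, ?_⟩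
  · simp only [h, coordSupport_zero, Finset.empty_subset, if_true]
    simpa using hb 0 (Nat.zero_le _)
  · intro u
    simp only [pullback, card_parents, coordSupport_add_single, h, sum_add_single]
    by_cases hu : coordSupport u ⊆ I
    · set s := ∑ j, u j
      set k := (coordSupport u).card with hk
      have hki : k ≤ i := hcard hu
      -- Raising a coordinate of the support keeps k, raising another one in `I` gives k + 1, and
      -- leaving `I` contributes 0.
      have hterm (j : Fin (d + 1)) : (α (insert j (coordSupport u)).card *
          if insert j (coordSupport u) ⊆ I then
            b (insert j (coordSupport u)).card * r ^ (s + 1) else 0) =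
          (if j ∈ coordSupport u then α k * (b k * r ^ (s + 1)) else 0) +
          (if j ∈ I \ coordSupport u then α (k + 1) * (b (k + 1) * r ^ (s + 1)) else 0) := by
        by_cases hj : j ∈ coordSupport u
        · rw [Finset.insert_eq_of_mem hj]
          simp [hu, hj, hk]
        · rw [Finset.card_insert_of_notMem hj]
          by_cases hjI : j ∈ I
          · simp [Finset.insert_subset_iff, hu, hj, hjI, hk]
          · simp [Finset.insert_subset_iff, hj, hjI]
      rw [if_pos hu, Finset.sum_congr rfl fun j _ => hterm j, Finset.sum_add_distrib,
        Finset.sum_ite_mem, Finset.sum_ite_mem, Finset.univ_inter, Finset.univ_inter,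
        Finset.sum_const, Finset.sum_const, Finset.card_sdiff_of_subset hu, hI, ← hk,
        nsmul_eq_mul, nsmul_eq_mul]
      rcases hki.lt_or_eq with hlt | heq
      · linear_combination r ^ s * hbrec k hlt
      · rw [heq, Nat.sub_self]
        push_cast
        linear_combination -b i * r ^ s * hri
    · have (j : Fin (d + 1)) : ¬ insert j (coordSupport u) ⊆ I := fun hj =>
        hu ((Finset.subset_insert _ _).trans hj)
      simp [hu, this]
  · intro v
    rw [abs_of_nonneg (hnn v)]
    have hpos : ∀ k ∈ Finset.range (i + 1), 0 ≤ b k := fun k hk =>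
      (hb k (Nat.lt_succ_iff.1 (Finset.mem_range.1 hk))).le
    simp only [h]
    split_ifs with hv
    · exact mul_le_mul_of_nonneg_right (Finset.single_le_sum (f := b) hpos
        (Finset.mem_range.2 (Nat.lt_succ_iff.2 (hcard hv)))) (by positivity)
    · exact mul_nonneg (Finset.sum_nonneg hpos) (by positivity)

theorem IsModelInput.convexReconstructionPossible {Ω : Type*} [MeasurableSpace Ω] {P : Measure Ω}
    [IsProbabilityMeasure P] {μ₀ : ℝ} {v₀ : ℝ≥0} {X₀ : Ω → ℝ} {W : Edge d → Ω → ℝ}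
    (hXW : IsModelInput P μ₀ v₀ X₀ W) (hv₀ : 0 < v₀) {α : ℕ → ℝ}
    (hα : ∀ i ∈ Finset.Icc 1 (d + 1), 0 < α i)
    (hi : ∃ i ∈ Finset.Icc 1 (d + 1), 1 / (i : ℝ) < α i) (ε : ℝ) :
    ConvexReconstructionPossible P (signal α ε X₀ W) X₀ := by
  obtain ⟨h, hnn, h0, hh, B, r, hr₀, hr₁, hB⟩ := exists_decaying_fixedPoint hα hi
  obtain ⟨K, hK⟩ := exists_noiseVariance_le α ε hr₀ hr₁ hB
  have hv : (0 : ℝ) < v₀ := by exact_mod_cast hv₀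
  have hlow (t : ℕ) : 0 < h 0 ^ 2 * v₀ + noiseVariance α ε h t :=
    add_pos_of_pos_of_nonneg (by positivity) (noiseVariance_nonneg α ε h t)
  refine ⟨h, hnn, fun t => ?_, fun hlim => ?_⟩
  · rw [hXW.variance_estimator fun u _ => hh u]
    exact hlow t
  -- The noise bound K gives a positive lower bound for the correlation, independent of t.
  · have hpos : 0 < h 0 * v₀ / √((h 0 ^ 2 * v₀ + K) * v₀) := by
      have : 0 < h 0 ^ 2 * v₀ + K := (hlow 0).trans_le (by gcongr; exact hK 0)
      positivity
    refine hpos.not_ge (ge_of_tendsto' hlim fun t => ?_)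
    rw [hXW.corr_estimator fun u _ => hh u]
    have := hlow t
    gcongr
    exact hK t

/-! ### Subcritical case: fixed points vanishing at infinity -/

/-- Maximum principle: once `h` vanishes on larger supports, h(v) is α_k times a sum over k upper
neighbours with the same support; as kα_k ≤ 1, the neighbour with largest |h| dominates. -/
theorem exists_abs_le_of_fixedPoint {α : ℕ → ℝ} {h : Vertex d → ℝ} (hh : ∀ u, h u = pullback α h u)
    {k : ℕ} (hk : 1 ≤ k) (hα₀ : 0 < α k) (hα₁ : α k ≤ 1 / k)
    (hzero : ∀ v, (coordSupport v).card = k + 1 → h v = 0) {v : Vertex d}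
    (hv : (coordSupport v).card = k) :
    ∃ w, (coordSupport w).card = k ∧ ∑ i, w i = ∑ i, v i + 1 ∧ |h v| ≤ |h w| := by
  have hne : (coordSupport v).Nonempty := Finset.card_pos.1 (by omega)
  obtain ⟨j, hj, hmax⟩ := Finset.exists_max_image (coordSupport v)
    (fun j => |h (v + Pi.single j 1)|) hne
  have hcard {l : Fin (d + 1)} (hl : l ∈ coordSupport v) :
      (coordSupport (v + Pi.single l 1)).card = k := by
    rw [coordSupport_add_single, Finset.insert_eq_of_mem hl, hv]
  refine ⟨v + Pi.single j 1, hcard hj, sum_add_single v j, ?_⟩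
  have hsum : h v = ∑ l ∈ coordSupport v, α k * h (v + Pi.single l 1) := by
    rw [hh v, pullback, ← Finset.sum_subset (Finset.subset_univ (coordSupport v))]
    · refine Finset.sum_congr rfl fun l hl => ?_
      rw [card_parents, hcard hl]
    · intro l _ hl
      rw [hzero, mul_zero]
      rw [coordSupport_add_single, Finset.card_insert_of_notMem hl, hv]
  have hk' : (0 : ℝ) < k := by exact_mod_cast hk
  calc |h v| ≤ ∑ l ∈ coordSupport v, |α k * h (v + Pi.single l 1)| := by
        rw [hsum]; exact Finset.abs_sum_le_sum_abs _ _
    _ ≤ ∑ l ∈ coordSupport v, 1 / (k : ℝ) * |h (v + Pi.single j 1)| := by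
        refine Finset.sum_le_sum fun l hl => ?_
        rw [abs_mul, abs_of_pos hα₀]
        exact mul_le_mul hα₁ (hmax l hl) (abs_nonneg _) (by positivity)
    _ = |h (v + Pi.single j 1)| := by
        rw [Finset.sum_const, hv, nsmul_eq_mul]
        field_simp

theorem eq_zero_of_fixedPoint_of_tendsto {α : ℕ → ℝ} (hα₀ : ∀ i ∈ Finset.Icc 1 (d + 1), 0 < α i)
    (hα₁ : ∀ i ∈ Finset.Icc 1 (d + 1), α i ≤ 1 / (i : ℝ)) {h : Vertex d → ℝ}
    (hh : ∀ u, h u = pullback α h u) (hlim : Tendsto h cofinite (𝓝 0)) : h 0 = 0 := by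
  -- Downward induction on the support size k, starting from the vacuous case k = d + 2.
  have hface : ∀ m k, 1 ≤ k → k + m = d + 2 →
      ∀ v : Vertex d, (coordSupport v).card = k → h v = 0 := by
    intro m
    induction m with
    | zero =>
      intro k _ hkd v hv
      have := card_coordSupport_le v
      omega
    | succ m ih =>
      intro k hk hkm v hv
      have hmem : k ∈ Finset.Icc 1 (d + 1) := Finset.mem_Icc.2 ⟨hk, by omega⟩
      have hiter : ∀ n : ℕ, ∃ w, (coordSupport w).card = k ∧ ∑ i, w i = ∑ i, v i + n ∧
          |h v| ≤ |h w| := by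
        intro n
        induction n with
        | zero => exact ⟨v, hv, rfl, le_rfl⟩
        | succ n ihn =>
          obtain ⟨w, hw, hs, hle⟩ := ihn
          obtain ⟨w', hw', hs', hle'⟩ := exists_abs_le_of_fixedPoint hh hk (hα₀ k hmem)
            (hα₁ k hmem) (ih (k + 1) (by omega) (by omega)) hw
          exact ⟨w', hw', by omega, hle.trans hle'⟩
      -- The vertices w n lie in distinct layers, so they escape to infinity with |h(w n)| ≥ |h(v)|.
      choose w _ hws hwle using hiter
      have hinj : Function.Injective w := fun m n hmn => by
        have h1 := hws m
        have h2 := hws n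
        rw [hmn] at h1
        omega
      have hlim' : Tendsto (fun n => |h (w n)|) cofinite (𝓝 0) := by
        simpa using (hlim.comp hinj.tendsto_cofinite).abs
      exact abs_nonpos_iff.1 (ge_of_tendsto' hlim' hwle)
  rw [hh 0, pullback]
  refine Finset.sum_eq_zero fun j _ => ?_
  have hc : (coordSupport ((0 : Vertex d) + Pi.single j 1)).card = 1 := by
    rw [coordSupport_add_single, coordSupport_zero]
    rfl
  rw [hface (d + 1) 1 le_rfl (by omega) _ hc, mul_zero]

/-! ### Subcritical case: compactness and noise cost -/

/-- The pulled-back coefficients on all layers up to `t` of an estimator on layer `t`. -/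
noncomputable def backPropagation (α : ℕ → ℝ) (c : Vertex d → ℝ) (t : ℕ) (v : Vertex d) : ℝ :=
  (pullback α)^[t - ∑ i, v i] c v

theorem backPropagation_of_mem_layer (α : ℕ → ℝ) (c : Vertex d → ℝ) {t : ℕ} {v : Vertex d}
    (hv : v ∈ layer d t) : backPropagation α c t v = c v := by
  rw [backPropagation, mem_layer.1 hv, Nat.sub_self, Function.iterate_zero, id]

theorem backPropagation_eq_pullback (α : ℕ → ℝ) (c : Vertex d → ℝ) {t : ℕ} {v : Vertex d}
    (hv : ∑ i, v i < t) :
    backPropagation α c t v = pullback α (backPropagation α c t) v := by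
  simp only [backPropagation]
  rw [show t - ∑ i, v i = (t - (∑ i, v i + 1)) + 1 by omega, Function.iterate_succ_apply']
  simp only [pullback, backPropagation, sum_add_single]

theorem estimator_backPropagation {Ω : Type*} (X : Vertex d → Ω → ℝ) (α : ℕ → ℝ)
    (c : Vertex d → ℝ) (t : ℕ) : estimator X (backPropagation α c t) t = estimator X c t :=
  funext fun _ => Finset.sum_congr rfl fun v hv => by rw [backPropagation_of_mem_layer α c hv]

/-- A nonzero vertex has between 1 and d + 1 parents, so its noise weight is at least a positive
minimum. -/
theorem exists_sum_sq_le_noiseVariance {α : ℕ → ℝ} (hα : ∀ i ∈ Finset.Icc 1 (d + 1), 0 < α i)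
    {ε : ℝ} (hε : 0 < ε) : ∃ κ : ℝ, 0 < κ ∧ ∀ (h : Vertex d → ℝ) (t : ℕ),
      κ * ∑ r ∈ Finset.range t, ∑ v ∈ layer d (r + 1), h v ^ 2 ≤ noiseVariance α ε h t := by
  obtain ⟨k, hk, hmin⟩ := Finset.exists_min_image (Finset.Icc 1 (d + 1))
    (fun k : ℕ => (k : ℝ) * (ε * α k) ^ 2) ⟨1, Finset.mem_Icc.2 ⟨le_rfl, by omega⟩⟩
  refine ⟨k * (ε * α k) ^ 2, ?_, fun h t => ?_⟩
  · have := hα k hk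
    have : (0 : ℝ) < k := by exact_mod_cast (Finset.mem_Icc.1 hk).1
    positivity
  · simp only [Finset.mul_sum]
    refine Finset.sum_le_sum fun r _ => Finset.sum_le_sum fun v hv => ?_
    have hv0 : (coordSupport v).Nonempty := by
      by_contra hne
      rw [Finset.not_nonempty_iff_eq_empty] at hne
      have : ∀ j, v j = 0 := fun j => by
        by_contra hj
        simpa [hne] using mem_coordSupport.2 hj
      simp [mem_layer, this] at hv
    have hmem : (parents v).card ∈ Finset.Icc 1 (d + 1) := by
      rw [card_parents, Finset.mem_Icc]
      exact ⟨hv0.card_pos, card_coordSupport_le v⟩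
    calc (k : ℝ) * (ε * α k) ^ 2 * h v ^ 2
        ≤ (parents v).card * (ε * α (parents v).card) ^ 2 * h v ^ 2 :=
          mul_le_mul_of_nonneg_right (hmin _ hmem) (sq_nonneg _)
      _ = _ := by ring

theorem sum_range_layer_eq (f : Vertex d → ℝ) (t : ℕ) :
    ∑ r ∈ Finset.range t, ∑ v ∈ layer d (r + 1), f v =
      ∑ v ∈ (Finset.range t).biUnion (fun r => layer d (r + 1)), f v := by
  rw [Finset.sum_biUnion]
  intro r _ s _ hrs
  refine Finset.disjoint_left.2 fun v hr hs => hrs ?_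
  rw [mem_layer] at hr hs
  omega

theorem sum_le_sum_range_layer {f : Vertex d → ℝ} (hf : ∀ v, 0 ≤ f v) {S : Finset (Vertex d)}
    {t : ℕ} (hS : ∀ v ∈ S, v ≠ 0 ∧ ∑ i, v i ≤ t) :
    ∑ v ∈ S, f v ≤ ∑ r ∈ Finset.range t, ∑ v ∈ layer d (r + 1), f v := by
  rw [sum_range_layer_eq]
  refine Finset.sum_le_sum_of_subset_of_nonneg (fun v hv => ?_) fun v _ _ => hf v
  obtain ⟨hv0, hvt⟩ := hS v hv
  have hpos : ∑ i, v i ≠ 0 := fun h0 => hv0 <| funext fun j => by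
    simpa using Finset.sum_eq_zero_iff.1 h0 j (Finset.mem_univ j)
  simp only [Finset.mem_biUnion, Finset.mem_range, mem_layer]
  exact ⟨∑ i, v i - 1, by omega, by omega⟩

/-- Coefficients with value one at the root that are consistent along the first `t` layers have a
sum of squares that grows beyond every bound as `t` grows. -/
theorem eventually_lt_sum_sq {α : ℕ → ℝ} (hα₀ : ∀ i ∈ Finset.Icc 1 (d + 1), 0 < α i)
    (hα₁ : ∀ i ∈ Finset.Icc 1 (d + 1), α i ≤ 1 / (i : ℝ)) (C : ℝ) :
    ∃ T : ℕ, ∀ t ≥ T, ∀ h : Vertex d → ℝ, h 0 = 1 → (∀ u, ∑ i, u i < t → h u = pullback α h u) →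
      C < ∑ r ∈ Finset.range t, ∑ v ∈ layer d (r + 1), h v ^ 2 := by
  by_contra! hcon
  choose t ht h h0 hh hC using hcon
  have hC0 : 0 ≤ C := (Finset.sum_nonneg fun _ _ => Finset.sum_nonneg fun _ _ => sq_nonneg _).trans
    (hC 0)
  -- If the sums stayed at most C for arbitrarily large t, the ultrafilter limit of the
  -- counterexamples would be a square-summable fixed point with root value 1. The ultrafilter gives
  -- all pointwise limits at once, without a diagonal subsequence.
  let F : Ultrafilter ℕ := hyperfilter ℕ
  have hF : (F : Filter ℕ) ≤ atTop := Nat.cofinite_eq_atTop ▸ hyperfilter_le_cofinite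
  have hbound (S : Finset (Vertex d)) (hS : ∀ v ∈ S, v ≠ 0) :
      ∀ᶠ n in F, ∑ v ∈ S, h n v ^ 2 ≤ C := by
    filter_upwards [hF (eventually_ge_atTop (∑ v ∈ S, ∑ i, v i))] with n hn
    refine (sum_le_sum_range_layer (fun v => sq_nonneg (h n v)) fun v hv => ⟨hS v hv, ?_⟩).trans
      (hC n)
    exact ((Finset.single_le_sum (f := fun v : Vertex d => ∑ i, v i) (fun _ _ => Nat.zero_le _)
      hv).trans hn).trans (ht n)
  have hex (v : Vertex d) : ∃ x, Tendsto (fun n => h n v) F (𝓝 x) := by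
    by_cases hv : v = 0
    · subst hv
      exact ⟨1, by simp only [h0]; exact tendsto_const_nhds⟩
    have hmem : ∀ᶠ n in F, h n v ∈ Set.Icc (-√C) (√C) := by
      filter_upwards [hbound {v} (by simpa using hv)] with n hn
      rw [Finset.sum_singleton] at hn
      exact abs_le.1 (Real.abs_le_sqrt hn)
    obtain ⟨x, -, hx⟩ := (isCompact_Icc (a := -√C) (b := √C)).ultrafilter_le_nhds
      (F.map fun n => h n v) (le_principal_iff.2 hmem)
    exact ⟨x, hx⟩
  choose g hg using hex
  have hg0 : g 0 = 1 := tendsto_nhds_unique (hg 0) (by simp only [h0]; exact tendsto_const_nhds)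
  have hgfix (u : Vertex d) : g u = pullback α g u := by
    have h1 : Tendsto (fun n => pullback α (h n) u) F (𝓝 (pullback α g u)) :=
      tendsto_finsetSum _ fun j _ => (hg _).const_mul _
    refine tendsto_nhds_unique (hg u) (h1.congr' ?_)
    filter_upwards [hF (eventually_gt_atTop (∑ i, u i))] with n hn
    exact (hh n u (lt_of_lt_of_le hn (ht n))).symm
  have hsum (S : Finset (Vertex d)) : ∑ v ∈ S, g v ^ 2 ≤ C + 1 := by
    have h1 : ∑ v ∈ S.erase 0, g v ^ 2 ≤ C :=
      le_of_tendsto (tendsto_finsetSum _ fun v _ => (hg v).pow 2)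
        (hbound (S.erase 0) fun v hv => Finset.ne_of_mem_erase hv)
    calc ∑ v ∈ S, g v ^ 2 ≤ ∑ v ∈ insert 0 (S.erase 0), g v ^ 2 :=
          Finset.sum_le_sum_of_subset_of_nonneg (Finset.insert_erase_subset 0 S)
            fun _ _ _ => sq_nonneg _
      _ = g 0 ^ 2 + ∑ v ∈ S.erase 0, g v ^ 2 := Finset.sum_insert (Finset.notMem_erase 0 S)
      _ ≤ C + 1 := by rw [hg0]; linarith
  have hlim : Tendsto g cofinite (𝓝 0) := by
    have h1 := (summable_of_sum_le (fun v => sq_nonneg (g v)) hsum).tendsto_cofinite_zero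
    have h2 := h1.sqrt
    simp only [Real.sqrt_sq_eq_abs, Real.sqrt_zero] at h2
    exact (tendsto_zero_iff_abs_tendsto_zero g).2 h2
  have := eq_zero_of_fixedPoint_of_tendsto hα₀ hα₁ hgfix hlim
  linarith

/-! ### Subcritical case: decay of correlations -/

namespace IsModelInput

variable {Ω : Type*} [MeasurableSpace Ω] {P : Measure Ω} [IsProbabilityMeasure P] {μ₀ : ℝ}
  {v₀ : ℝ≥0} {X₀ : Ω → ℝ} {W : Edge d → Ω → ℝ}

theorem eventually_abs_corr_le (hXW : IsModelInput P μ₀ v₀ X₀ W) (hv₀ : 0 < v₀) {α : ℕ → ℝ}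
    (hα₀ : ∀ i ∈ Finset.Icc 1 (d + 1), 0 < α i)
    (hα₁ : ∀ i ∈ Finset.Icc 1 (d + 1), α i ≤ 1 / (i : ℝ)) {ε : ℝ} (hε : 0 < ε) {η : ℝ}
    (hη : 0 < η) :
    ∃ T : ℕ, ∀ t ≥ T, ∀ c : Vertex d → ℝ,
      |corr P (estimator (signal α ε X₀ W) c t) X₀| ≤ η := by
  have hv : (0 : ℝ) < v₀ := by exact_mod_cast hv₀
  obtain ⟨κ, hκ, hnoise⟩ := exists_sum_sq_le_noiseVariance hα₀ hε
  -- The threshold makes the noise variance N at least v₀h(0)²/η², so the squared correlation is at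
  -- most h(0)²v₀/N ≤ η².
  obtain ⟨T, hT⟩ := eventually_lt_sum_sq hα₀ hα₁ (v₀ / η ^ 2 / κ)
  refine ⟨T, fun t ht c => ?_⟩
  set h := backPropagation α c t
  have hh : ∀ u, ∑ i, u i < t → h u = pullback α h u := fun u hu =>
    backPropagation_eq_pullback α c hu
  rw [← estimator_backPropagation _ α, hXW.corr_estimator hh]
  change |h 0 * v₀ / √((h 0 ^ 2 * v₀ + noiseVariance α ε h t) * v₀)| ≤ η
  rcases eq_or_ne (h 0) 0 with h0 | h0
  · simp [h0, hη.le]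
  -- `pullback` is linear, so `h` may be normalized to 1 at the root.
  have hbig := hT t ht (fun v => h v / h 0) (div_self h0) (fun u hu => by
    rw [hh u hu, pullback, pullback, Finset.sum_div]
    exact Finset.sum_congr rfl fun j _ => mul_div_assoc _ _ _)
  have hsq : 0 < h 0 ^ 2 := by positivity
  have hN : v₀ / η ^ 2 * h 0 ^ 2 ≤ noiseVariance α ε h t := by
    refine le_trans ?_ (hnoise h t)
    simp only [div_pow, ← Finset.sum_div] at hbig
    rw [lt_div_iff₀ hsq, div_mul_eq_mul_div, div_lt_iff₀ hκ] at hbig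
    linarith
  set N := noiseVariance α ε h t
  have hN0 : 0 ≤ N := noiseVariance_nonneg α ε h t
  have hpos : 0 < (h 0 ^ 2 * v₀ + N) * v₀ := by positivity
  rw [abs_div, abs_of_nonneg (Real.sqrt_nonneg _), div_le_iff₀ (Real.sqrt_pos.2 hpos),
    ← Real.sqrt_sq hη.le, ← Real.sqrt_mul (sq_nonneg η)]
  apply Real.abs_le_sqrt
  rw [div_mul_eq_mul_div, div_le_iff₀ (by positivity)] at hN
  have : 0 ≤ η ^ 2 * (h 0 ^ 2 * v₀) * v₀ := by positivity
  nlinarith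

theorem not_reconstructionPossible (hXW : IsModelInput P μ₀ v₀ X₀ W) (hv₀ : 0 < v₀) {α : ℕ → ℝ}
    (hα₀ : ∀ i ∈ Finset.Icc 1 (d + 1), 0 < α i)
    (hα₁ : ∀ i ∈ Finset.Icc 1 (d + 1), α i ≤ 1 / (i : ℝ)) {ε : ℝ} (hε : 0 < ε) :
    ¬ ReconstructionPossible P (signal α ε X₀ W) X₀ := by
  rintro ⟨c, -, hc⟩
  refine hc (Metric.tendsto_atTop.2 fun η hη => ?_)
  obtain ⟨T, hT⟩ := hXW.eventually_abs_corr_le hv₀ hα₀ hα₁ hε (half_pos hη)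
  refine ⟨T, fun t ht => ?_⟩
  rw [Real.dist_eq, sub_zero]
  exact (hT t ht c).trans_lt (half_lt_self hη)

theorem tendsto_bestCorr (hXW : IsModelInput P μ₀ v₀ X₀ W) (hv₀ : 0 < v₀) {α : ℕ → ℝ}
    (hα₀ : ∀ i ∈ Finset.Icc 1 (d + 1), 0 < α i)
    (hα₁ : ∀ i ∈ Finset.Icc 1 (d + 1), α i ≤ 1 / (i : ℝ)) {ε : ℝ} (hε : 0 < ε) :
    Tendsto (fun t => bestCorr P (signal α ε X₀ W) X₀ t) atTop (𝓝 0) := by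
  rw [tendsto_order]
  constructor
  · intro a ha
    obtain ⟨x, hax, hx⟩ := EReal.lt_iff_exists_real_btwn.1 ha
    have hx' : x < 0 := by exact_mod_cast hx
    obtain ⟨T, hT⟩ := hXW.eventually_abs_corr_le hv₀ hα₀ hα₁ hε (neg_pos.2 hx')
    filter_upwards [eventually_ge_atTop T] with t ht
    have hmem : (Pi.single 0 t : Vertex d) ∈ layer d t := by simp [mem_layer]
    -- Any admissible coefficients bound the supremum from below, since the correlation bound is
    -- two-sided and uniform in c.
    let c : {c : Vertex d → ℝ // ∃ u ∈ layer d t, c u ≠ 0} :=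
      ⟨fun _ => 1, Pi.single 0 t, hmem, one_ne_zero⟩
    have hc : x ≤ corr P (estimator (signal α ε X₀ W) c.1 t) X₀ := by
      linarith [(abs_le.1 (hT t ht c.1)).1]
    exact hax.trans_le ((EReal.coe_le_coe_iff.2 hc).trans (le_iSup (fun c : {c : Vertex d → ℝ //
      ∃ u ∈ layer d t, c u ≠ 0} =>
        ((corr P (estimator (signal α ε X₀ W) c.1 t) X₀ : ℝ) : EReal)) c))
  · intro a ha
    obtain ⟨x, hx, hxa⟩ := EReal.lt_iff_exists_real_btwn.1 ha
    have hx' : 0 < x := by exact_mod_cast hx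
    obtain ⟨T, hT⟩ := hXW.eventually_abs_corr_le hv₀ hα₀ hα₁ hε hx'
    filter_upwards [eventually_ge_atTop T] with t ht
    have hle : bestCorr P (signal α ε X₀ W) X₀ t ≤ (x : EReal) := by
      rw [bestCorr]
      refine iSup_le fun c => ?_
      have hc := (abs_le.1 (hT t ht c.1)).2
      exact_mod_cast hc
    exact hle.trans_lt hxa

end IsModelInput

end GaussianBroadcast

theorem theorem2p1 {Ω : Type*} [MeasurableSpace Ω] (P : Measure Ω) [IsProbabilityMeasure P]
    (d : ℕ) (α : ℕ → ℝ) (hα : ∀ i ∈ Finset.Icc 1 (d + 1), 0 < α i)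
    (ε : ℝ) (hε : 0 < ε) (μ₀ : ℝ) (v₀ : ℝ≥0) (hv₀ : 0 < v₀)
    (X₀ : Ω → ℝ) (W : GaussianBroadcast.Edge d → Ω → ℝ)
    (hXW : GaussianBroadcast.IsModelInput P μ₀ v₀ X₀ W) :
    ((∃ i ∈ Finset.Icc 1 (d + 1), 1 / (i : ℝ) < α i) →
      GaussianBroadcast.ConvexReconstructionPossible P
        (GaussianBroadcast.signal α ε X₀ W) X₀) ∧
    ((∀ i ∈ Finset.Icc 1 (d + 1), α i ≤ 1 / (i : ℝ)) →
      ¬ GaussianBroadcast.ReconstructionPossible P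
          (GaussianBroadcast.signal α ε X₀ W) X₀ ∧
      Tendsto (fun t => GaussianBroadcast.bestCorr P
        (GaussianBroadcast.signal α ε X₀ W) X₀ t) atTop (𝓝 0)) := by
  exact ⟨fun hi => hXW.convexReconstructionPossible hv₀ hα hi ε,
    fun hα₁ => ⟨hXW.not_reconstructionPossible hv₀ hα hα₁ hε,
      hXW.tendsto_bestCorr hv₀ hα hα₁ hε⟩⟩
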